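/- Let $\mathbb K$ be $\mathbb R$ or $\mathbb C$ and let $X$ be a topological space. A Banach bundle over $X$ is a continuous open surjection $\pi:\mathcal E\to X$ together with a $\mathbb K$-Banach space structure on each fiber $\mathcal E_x=\pi^{-1}(x)$, such that scalar multiplication $\mathbb K\times\mathcal E\to\mathcal E$ and addition $\mathcal E\times_X\mathcal E\to\mathcal E$ are continuous, the norm $\|\cdot\|:\mathcal E\to\mathbb R_{\ge 0}$ is upper semicontinuous, and for every $x\in X$ the sets $\{p\in\mathcal E : \pi(p)\in U,\ \|p\|<\varepsilon\}$, with $U$ a neighborhood of $x$ and $\varepsilon>0$, form a fundamental system of neighborhoods of the zero element $0_x\in\mathcal E_x$. It is an (F) Banach bundle if the norm is moreover continuous on $\mathcal E$, an (F) Hilbert bundle if in addition the norm of every fiber is induced by an inner product, and homogeneous if there is an integer $n\ge 0$ such that all fibers have dimension $n$. Let $X$ be a Hausdorff space in which every point has a closed paracompact neighborhood, and let $\pi:\mathcal E\to X$ be a homogeneous (F) Banach bundle. Then $\mathcal E$ is unitarizable: there are an (F) Hilbert bundle $\pi':\mathcal E'\to X$ and a homeomorphism $\Phi:\mathcal E\to\mathcal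 E'$ with $\pi'\circ\Phi=\pi$ whose restriction $\mathcal E_x\to\mathcal E'_x$ is linear for every $x\in X$. -/

import Mathlib

open Topology Bundle

universe u v w

/-- Every point has a closed paracompact neighbourhood. -/
def IsLocallyParacompact (X : Type u) [TopologicalSpace X] : Prop :=
  ∀ x : X, ∃ N ∈ 𝓝 x, IsClosed N ∧ ParacompactSpace N

/-- A Banach bundle over `X`, presented through the family of its fibers together with a topology
on the disjoint union of the fibers. The first argument of `TotalSpace` is a phantom argument, and
`E ×ᵇ E` carries the topology of the fiber product `{(p, q) | π p = π q} ⊆ E × E`.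
The norm is only required to be upper semicontinuous here; see `BanachBundle.IsContinuous`. -/
structure BanachBundle (𝕜 : Type w) [RCLike 𝕜] (X : Type u) [TopologicalSpace X] where
  fiber : X → Type v
  [normedAddCommGroup : ∀ x, NormedAddCommGroup (fiber x)]
  [normedSpace : ∀ x, NormedSpace 𝕜 (fiber x)]
  [completeSpace : ∀ x, CompleteSpace (fiber x)]
  [topology : TopologicalSpace (TotalSpace 𝕜 fiber)]
  continuous_proj : Continuous (TotalSpace.proj : TotalSpace 𝕜 fiber → X)
  isOpenMap_proj : IsOpenMap (TotalSpace.proj : TotalSpace 𝕜 fiber → X)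
  continuous_smul : Continuous
    (fun q : 𝕜 × TotalSpace 𝕜 fiber => (⟨q.2.proj, q.1 • q.2.snd⟩ : TotalSpace 𝕜 fiber))
  continuous_add : Continuous
    (fun q : TotalSpace (𝕜 × 𝕜) (fiber ×ᵇ fiber) =>
      (⟨q.proj, q.snd.1 + q.snd.2⟩ : TotalSpace 𝕜 fiber))
  upperSemicontinuous_norm : UpperSemicontinuous (fun p : TotalSpace 𝕜 fiber => ‖p.snd‖)
  hasBasis_nhds_zero : ∀ x : X,
    (𝓝 (⟨x, 0⟩ : TotalSpace 𝕜 fiber)).HasBasis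
      (fun i : Set X × ℝ => i.1 ∈ 𝓝 x ∧ 0 < i.2)
      (fun i => {p | p.proj ∈ i.1 ∧ ‖p.snd‖ < i.2})

namespace BanachBundle

attribute [instance] normedAddCommGroup normedSpace completeSpace topology

variable {𝕜 : Type w} [RCLike 𝕜] {X : Type u} [TopologicalSpace X]

/-- (F) bundles: the norm is continuous on the total space. -/
def IsContinuous (E : BanachBundle.{u, v, w} 𝕜 X) : Prop :=
  Continuous (fun p : TotalSpace 𝕜 E.fiber => ‖p.snd‖)

/-- All fibers have (finite) dimension `n`. -/
def IsHomogeneous (E : BanachBundle.{u, v, w} 𝕜 X) (n : ℕ) : Prop :=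
  ∀ x, Module.rank 𝕜 (E.fiber x) = n

/-- A bundle of Hilbert spaces: the given norm of each fiber comes from an inner product. -/
def IsHilbert (E : BanachBundle.{u, v, w} 𝕜 X) : Prop :=
  ∀ x, ∃ I : InnerProductSpace 𝕜 (E.fiber x), I.toNormedSpace = E.normedSpace x

/-- Equivalence of bundles: a homeomorphism of the total spaces over `X` that is linear along each
fiber. No compatibility with the norms is asked for. -/
def Equivalent (E E' : BanachBundle.{u, v, w} 𝕜 X) : Prop :=
  ∃ L : ∀ x, E.fiber x ≃ₗ[𝕜] E'.fiber x,
    IsHomeomorph (fun p : TotalSpace 𝕜 E.fiber =>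
      (⟨p.proj, L p.proj p.snd⟩ : TotalSpace 𝕜 E'.fiber))

/-- Equivalence to a Hilbert bundle, which is required to be an (F) bundle if `E` is one. -/
def IsUnitarizable (E : BanachBundle.{u, v, w} 𝕜 X) : Prop :=
  ∃ E' : BanachBundle.{u, v, w} 𝕜 X,
    E'.IsHilbert ∧ (E.IsContinuous → E'.IsContinuous) ∧ E.Equivalent E'

end BanachBundle

/-! Averaging `|φ v|²` over the unit ball of the dual attaches to every finite-dimensional normed
space an inner product determined by the norm alone. Being canonical, it is stable: an isomorphism
distorting norms by at most `A` distorts the averaged norm by at most a power of `A` depending only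
on the dimension (`dualBallNorm_distortion`). Nearby fibers of an (F) bundle are almost isometric
(`eventually_exists_almost_isometry`), so the averaged norm is continuous on the total space
(`continuous_dualBallNorm`). It is equivalent to the given norm with constants depending only on the
dimension, so the same total space, renormed, is a Hilbert bundle and the equivalence is the
identity. -/

/-! ### Averaging over the dual unit ball. -/

section DualBall

open MeasureTheory Metric ComplexConjugate Pointwise

set_option linter.unusedSectionVars false

variable {𝕜 : Type*} [RCLike 𝕜] {V W : Type*}
  [NormedAddCommGroup V] [NormedSpace 𝕜 V] [FiniteDimensional 𝕜 V]
  [MeasurableSpace (StrongDual 𝕜 V)] [BorelSpace (StrongDual 𝕜 V)]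
  [NormedAddCommGroup W] [NormedSpace 𝕜 W] [FiniteDimensional 𝕜 W]
  [MeasurableSpace (StrongDual 𝕜 W)] [BorelSpace (StrongDual 𝕜 W)]
  (μ : Measure (StrongDual 𝕜 V)) [μ.IsAddHaarMeasure]

/-- The mean of `|φ v|²` over the unit ball of the dual space. -/
noncomputable def dualBallQuadratic (μ : Measure (StrongDual 𝕜 V)) (v : V) : ℝ :=
  ⨍ φ in closedBall (0 : StrongDual 𝕜 V) 1, ‖φ v‖ ^ 2 ∂μ

/-- The mean of `conj (φ u) * φ v` over the unit ball of the dual space. -/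
noncomputable def dualBallInner (μ : Measure (StrongDual 𝕜 V)) (u v : V) : 𝕜 :=
  ⨍ φ in closedBall (0 : StrongDual 𝕜 V) 1, conj (φ u) * φ v ∂μ

theorem StrongDual.finiteDimensional_real : FiniteDimensional ℝ (StrongDual 𝕜 V) :=
  have : FiniteDimensional 𝕜 (StrongDual 𝕜 V) :=
    FiniteDimensional.of_injective (ContinuousLinearMap.coeLM 𝕜 : StrongDual 𝕜 V →ₗ[𝕜] _)
      ContinuousLinearMap.coe_injective
  FiniteDimensional.trans ℝ 𝕜 _

theorem StrongDual.properSpace : ProperSpace (StrongDual 𝕜 V) :=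
  have := StrongDual.finiteDimensional_real (𝕜 := 𝕜) (V := V)
  FiniteDimensional.proper_real _

theorem integrableOn_dualBall {F : Type*} [NormedAddCommGroup F] {f : StrongDual 𝕜 V → F}
    (hf : Continuous f) (r : ℝ) : IntegrableOn f (closedBall 0 r) μ :=
  have := StrongDual.properSpace (𝕜 := 𝕜) (V := V)
  hf.continuousOn.integrableOn_compact (isCompact_closedBall 0 r)

theorem dualBall_real_pos {r : ℝ} (hr : 0 < r) (φ : StrongDual 𝕜 V) :
    0 < μ.real (closedBall φ r) :=
  have := StrongDual.properSpace (𝕜 := 𝕜) (V := V)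
  ENNReal.toReal_pos (measure_closedBall_pos μ φ hr).ne' measure_closedBall_lt_top.ne

theorem dualBall_real (φ : StrongDual 𝕜 V) {r : ℝ} (hr : 0 ≤ r) :
    μ.real (closedBall φ r) =
      r ^ Module.finrank ℝ (StrongDual 𝕜 V) * μ.real (closedBall 0 1) := by
  have := StrongDual.finiteDimensional_real (𝕜 := 𝕜) (V := V)
  rw [measureReal_def, Measure.addHaar_closedBall' μ φ hr, ENNReal.toReal_mul,
    ENNReal.toReal_ofReal (by positivity), measureReal_def]

/-- Substitute `φ ↦ r φ`: the volume contributes the dimension to the exponent, the quadratic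
integrand contributes `2`. -/
theorem integral_dualBall_scale (v : V) {r : ℝ} (hr : 0 < r) :
    ∫ φ in closedBall (0 : StrongDual 𝕜 V) r, ‖φ v‖ ^ 2 ∂μ =
      r ^ (Module.finrank ℝ (StrongDual 𝕜 V) + 2) *
        ∫ φ in closedBall (0 : StrongDual 𝕜 V) 1, ‖φ v‖ ^ 2 ∂μ := by
  have := StrongDual.finiteDimensional_real (𝕜 := 𝕜) (V := V)
  have h := Measure.setIntegral_comp_smul_of_pos μ (fun φ : StrongDual 𝕜 V => ‖φ v‖ ^ 2)
    (closedBall 0 1) hr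
  have hs : r • closedBall (0 : StrongDual 𝕜 V) 1 = closedBall 0 r := by
    simp [smul_closedBall r (0 : StrongDual 𝕜 V) zero_le_one, abs_of_pos hr]
  have hn (φ : StrongDual 𝕜 V) : ‖(r • φ) v‖ ^ 2 = r ^ 2 * ‖φ v‖ ^ 2 := by
    rw [smul_apply, norm_smul, mul_pow, Real.norm_eq_abs, sq_abs]
  simp only [hn, hs, integral_const_mul, smul_eq_mul] at h
  rw [eq_inv_mul_iff_mul_eq₀ (by positivity)] at h
  rw [← h]
  ring

theorem dualBallQuadratic_eq (v : V) :
    dualBallQuadratic μ v = (μ.real (closedBall 0 1))⁻¹ *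
      ∫ φ in closedBall (0 : StrongDual 𝕜 V) 1, ‖φ v‖ ^ 2 ∂μ := by
  rw [dualBallQuadratic, setAverage_eq, smul_eq_mul]

theorem continuous_dual_sq (v : V) : Continuous fun φ : StrongDual 𝕜 V => ‖φ v‖ ^ 2 := by
  fun_prop

theorem continuous_conj_mul (u v : V) :
    Continuous fun φ : StrongDual 𝕜 V => conj (φ u) * φ v :=
  (RCLike.continuous_conj.comp (by fun_prop : Continuous fun φ : StrongDual 𝕜 V => φ u)).mul
    (by fun_prop)

theorem dualBallQuadratic_nonneg (v : V) : 0 ≤ dualBallQuadratic μ v := by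
  rw [dualBallQuadratic_eq]
  positivity

theorem dualBallQuadratic_le (v : V) : dualBallQuadratic μ v ≤ ‖v‖ ^ 2 := by
  have := StrongDual.properSpace (𝕜 := 𝕜) (V := V)
  have hpos := dualBall_real_pos μ one_pos 0
  rw [dualBallQuadratic_eq, inv_mul_le_iff₀ hpos]
  calc ∫ φ in closedBall (0 : StrongDual 𝕜 V) 1, ‖φ v‖ ^ 2 ∂μ
      ≤ ∫ φ in closedBall (0 : StrongDual 𝕜 V) 1, ‖v‖ ^ 2 ∂μ := by
        refine setIntegral_mono_on (integrableOn_dualBall μ (continuous_dual_sq v) 1)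
          (integrableOn_dualBall μ continuous_const 1) measurableSet_closedBall fun φ hφ => ?_
        gcongr
        rw [mem_closedBall_zero_iff] at hφ
        exact φ.le_of_opNorm_le_of_le hφ le_rfl |>.trans_eq (one_mul _)
    _ = _ := by simp

/-- If `g` norms `v`, the ball of radius `1/4` about `g/2` lies in the unit ball, fills the fraction
`(1/4)^d` of its volume, and satisfies `‖φ v‖ ≥ ‖v‖/2 - ‖v‖/4` throughout. -/
theorem le_dualBallQuadratic (v : V) :
    (1 / 4) ^ (Module.finrank ℝ (StrongDual 𝕜 V) + 2) * ‖v‖ ^ 2 ≤ dualBallQuadratic μ v := by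
  have := StrongDual.properSpace (𝕜 := 𝕜) (V := V)
  have hpos := dualBall_real_pos μ one_pos 0
  obtain ⟨g, hg, hgv⟩ := exists_dual_vector'' 𝕜 v
  have hsub : closedBall ((1 / 2 : ℝ) • g) (1 / 4) ⊆ closedBall 0 1 := by
    apply closedBall_subset_closedBall'
    rw [dist_zero_right, norm_smul]
    norm_num
    linarith
  rw [dualBallQuadratic_eq, le_inv_mul_iff₀ hpos]
  calc μ.real (closedBall 0 1) *
        ((1 / 4) ^ (Module.finrank ℝ (StrongDual 𝕜 V) + 2) * ‖v‖ ^ 2)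
      = ∫ φ in closedBall ((1 / 2 : ℝ) • g) (1 / 4), (‖v‖ / 4) ^ 2 ∂μ := by
        rw [setIntegral_const, dualBall_real μ ((1 / 2 : ℝ) • g) (r := 1 / 4) (by norm_num), smul_eq_mul]
        ring
    _ ≤ ∫ φ in closedBall ((1 / 2 : ℝ) • g) (1 / 4), ‖φ v‖ ^ 2 ∂μ := by
        refine setIntegral_mono_on (integrableOn_const measure_closedBall_lt_top.ne)
          ((integrableOn_dualBall μ (continuous_dual_sq v) 1).mono_set hsub)
          measurableSet_closedBall fun φ hφ => ?_
        gcongr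
        rw [mem_closedBall, dist_eq_norm] at hφ
        have h1 := (φ - (1 / 2 : ℝ) • g).le_of_opNorm_le hφ v
        have h2 : ‖((1 / 2 : ℝ) • g) v‖ = ‖v‖ / 2 := by
          rw [smul_apply, hgv, norm_smul]
          norm_num
          ring
        have h3 := norm_sub_norm_le (((1 / 2 : ℝ) • g) v) (φ v)
        rw [norm_sub_rev, ← sub_apply] at h3
        linarith
    _ ≤ _ := setIntegral_mono_set (integrableOn_dualBall μ (continuous_dual_sq v) 1)
        (ae_of_all _ fun _ => by positivity) hsub.eventuallyLE

/-- Haar measures are proportional and the factor cancels in a mean. Hence the measures may be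
chosen fiber by fiber, with no coherence. -/
theorem dualBallQuadratic_eq_of_haar (ρ : Measure (StrongDual 𝕜 V)) [ρ.IsAddHaarMeasure] (v : V) :
    dualBallQuadratic ρ v = dualBallQuadratic μ v := by
  have := StrongDual.properSpace (𝕜 := 𝕜) (V := V)
  have := StrongDual.finiteDimensional_real (𝕜 := 𝕜) (V := V)
  have h := Measure.isAddLeftInvariant_eq_smul ρ μ
  have hc : (ρ.addHaarScalarFactor μ : ℝ) ≠ 0 := by
    exact_mod_cast (Measure.addHaarScalarFactor_pos_of_isAddHaarMeasure ρ μ).ne'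
  rw [dualBallQuadratic_eq, dualBallQuadratic_eq, h, Measure.restrict_smul,
    integral_smul_nnreal_measure, measureReal_nnreal_smul_apply, NNReal.smul_def, smul_eq_mul]
  field_simp

/-- The transpose of `T` carries the dual unit ball of `W` to a set `K` between the balls of radii
`A⁻¹` and `A`. The integral over `K` gains at most `A^(d+2)` and the volume of `K` loses at most
`A^d`. -/
theorem dualBallQuadratic_distortion (ν : Measure (StrongDual 𝕜 W)) [ν.IsAddHaarMeasure]
    (T : V ≃ₗ[𝕜] W) {A : ℝ} (hA : 0 < A) (h₁ : ∀ v, ‖T v‖ ≤ A * ‖v‖) (h₂ : ∀ v, ‖v‖ ≤ A * ‖T v‖)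
    (v : V) :
    dualBallQuadratic ν (T v) ≤
      A ^ (2 * Module.finrank ℝ (StrongDual 𝕜 V) + 2) * dualBallQuadratic μ v := by
  have := StrongDual.properSpace (𝕜 := 𝕜) (V := V)
  let S : StrongDual 𝕜 W ≃L[𝕜] StrongDual 𝕜 V :=
    T.toContinuousLinearEquiv.symm.arrowCongr (ContinuousLinearEquiv.refl 𝕜 𝕜)
  have hS (ψ : StrongDual 𝕜 W) (v : V) : S ψ v = ψ (T v) := rfl
  have hS' (φ : StrongDual 𝕜 V) (v : V) : S.symm φ (T v) = φ v := by
    rw [← hS, S.apply_symm_apply]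
  let ρ := ν.map S
  have hρ : ρ.IsAddHaarMeasure := S.isAddHaarMeasure_map ν
  have hpos := dualBall_real_pos ρ one_pos 0
  have hSe : MeasurableEmbedding S := S.toHomeomorph.measurableEmbedding
  let K : Set (StrongDual 𝕜 V) := S.symm ⁻¹' closedBall 0 1
  have hK : S ⁻¹' K = closedBall 0 1 := by
    ext; simp [K]
  have hK₁ : K ⊆ closedBall 0 A := by
    intro φ hφ
    have hφ : ‖S.symm φ‖ ≤ 1 := by simpa [K] using hφ
    rw [mem_closedBall_zero_iff]
    refine φ.opNorm_le_bound hA.le fun v => ?_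
    rw [← hS']
    exact ((S.symm φ).le_of_opNorm_le hφ _).trans ((one_mul _).trans_le (h₁ v))
  have hK₂ : closedBall 0 A⁻¹ ⊆ K := by
    intro φ hφ
    rw [mem_closedBall_zero_iff] at hφ
    have : ‖S.symm φ‖ ≤ 1 := by
      refine (S.symm φ).opNorm_le_bound zero_le_one fun w => ?_
      obtain ⟨v, rfl⟩ := T.surjective w
      rw [hS', one_mul]
      refine (φ.le_of_opNorm_le hφ v).trans ?_
      rw [inv_mul_le_iff₀ hA]
      exact h₂ v
    simpa [K] using this
  have hKfin : ρ K ≠ ⊤ := ((measure_mono hK₁).trans_lt measure_closedBall_lt_top).ne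
  have e₁ : ν.real (closedBall 0 1) = ρ.real K := by
    rw [measureReal_def, measureReal_def, hSe.map_apply, hK]
  have e₂ : ∫ ψ in closedBall (0 : StrongDual 𝕜 W) 1, ‖ψ (T v)‖ ^ 2 ∂ν =
      ∫ φ in K, ‖φ v‖ ^ 2 ∂ρ := by
    rw [hSe.setIntegral_map, hK]
    rfl
  have i₁ : ∫ φ in K, ‖φ v‖ ^ 2 ∂ρ ≤ A ^ (Module.finrank ℝ (StrongDual 𝕜 V) + 2) *
      ∫ φ in closedBall (0 : StrongDual 𝕜 V) 1, ‖φ v‖ ^ 2 ∂ρ := by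
    rw [← integral_dualBall_scale ρ v hA]
    exact setIntegral_mono_set (integrableOn_dualBall ρ (continuous_dual_sq v) A)
      (ae_of_all _ fun _ => by positivity) hK₁.eventuallyLE
  have i₂ : A⁻¹ ^ Module.finrank ℝ (StrongDual 𝕜 V) * ρ.real (closedBall 0 1) ≤ ρ.real K := by
    rw [← dualBall_real ρ 0 (by positivity)]
    exact measureReal_mono hK₂ hKfin
  rw [← dualBallQuadratic_eq_of_haar μ ρ, dualBallQuadratic_eq, dualBallQuadratic_eq, e₁, e₂]
  have hi : (0 : ℝ) ≤ ∫ φ in closedBall (0 : StrongDual 𝕜 V) 1, ‖φ v‖ ^ 2 ∂ρ := by positivity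
  calc _ ≤ (A⁻¹ ^ Module.finrank ℝ (StrongDual 𝕜 V) * ρ.real (closedBall 0 1))⁻¹ *
        (A ^ (Module.finrank ℝ (StrongDual 𝕜 V) + 2) *
          ∫ φ in closedBall (0 : StrongDual 𝕜 V) 1, ‖φ v‖ ^ 2 ∂ρ) := by
        gcongr
    _ = _ := by
        rw [inv_pow]
        field_simp
        ring

theorem dualBallInner_self (v : V) :
    dualBallInner μ v v = ((dualBallQuadratic μ v : ℝ) : 𝕜) := by
  rw [dualBallInner, dualBallQuadratic, setAverage_eq, setAverage_eq, smul_eq_mul,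
    RCLike.ofReal_mul, ← integral_ofReal, RCLike.real_smul_eq_coe_mul]
  congr 2
  ext φ
  rw [RCLike.conj_mul, RCLike.ofReal_pow]

/-- The inner product obtained by averaging over the unit ball of the dual space. -/
@[reducible]
noncomputable def dualBallCore : InnerProductSpace.Core 𝕜 V where
  inner := dualBallInner μ
  conj_inner_symm x y := by
    simp only [dualBallInner, average, ← integral_conj, map_mul, RCLike.conj_conj]
    simp only [mul_comm]
  re_inner_nonneg x := by
    rw [dualBallInner_self, RCLike.ofReal_re]
    exact dualBallQuadratic_nonneg μ x
  add_left x y z := by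
    simp only [dualBallInner, setAverage_eq, map_add, add_mul]
    rw [integral_add, smul_add]
    · exact integrableOn_dualBall μ (continuous_conj_mul _ _) 1
    · exact integrableOn_dualBall μ (continuous_conj_mul _ _) 1
  smul_left x y r := by
    simp only [dualBallInner, average, ContinuousLinearMap.map_smul, smul_eq_mul, map_mul,
      mul_assoc, integral_const_mul]
  definite x hx := by
    rw [dualBallInner_self, RCLike.ofReal_eq_zero] at hx
    have h := le_dualBallQuadratic μ x
    rw [hx] at h
    have : ‖x‖ ^ 2 ≤ 0 := by
      by_contra! hc
      exact absurd h (not_le.2 (by positivity))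
    simpa using this.antisymm (by positivity)

/-- The Hilbert norm attached to the average over the unit ball of the dual space. -/
noncomputable def dualBallNorm (μ : Measure (StrongDual 𝕜 V)) (v : V) : ℝ :=
  √(dualBallQuadratic μ v)

theorem dualBallCore_norm (v : V) :
    (dualBallCore μ).toNormedAddCommGroup.toNorm.norm v = dualBallNorm μ v := by
  change √(RCLike.re (dualBallInner μ v v)) = _
  rw [dualBallInner_self, RCLike.ofReal_re, dualBallNorm]

theorem dualBallNorm_le (v : V) : dualBallNorm μ v ≤ ‖v‖ :=
  Real.sqrt_le_iff.2 ⟨norm_nonneg v, dualBallQuadratic_le μ v⟩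

theorem le_dualBallNorm (v : V) :
    (1 / 4) ^ (Module.finrank ℝ (StrongDual 𝕜 V) + 2) * ‖v‖ ≤ dualBallNorm μ v := by
  refine Real.le_sqrt_of_sq_le ((le_dualBallQuadratic μ v).trans' ?_)
  rw [mul_pow]
  gcongr
  -- The constant is at most `1`, so its square is no larger and no square root is needed.
  exact pow_le_of_le_one (by positivity) (pow_le_one₀ (by norm_num) (by norm_num)) two_ne_zero

theorem dualBallNorm_le_add (u v : V) : dualBallNorm μ u ≤ dualBallNorm μ v + ‖u - v‖ := by
  have h := @norm_le_norm_add_norm_sub' V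
    (dualBallCore μ).toNormedAddCommGroup.toSeminormedAddCommGroup.toSeminormedAddGroup u v
  have h' : dualBallNorm μ u ≤ dualBallNorm μ v + dualBallNorm μ (u - v) := by
    simpa only [← dualBallCore_norm] using h
  exact h'.trans (by gcongr; exact dualBallNorm_le μ _)

theorem dualBallNorm_distortion (ν : Measure (StrongDual 𝕜 W)) [ν.IsAddHaarMeasure]
    (T : V ≃ₗ[𝕜] W) {A : ℝ} (hA : 0 < A) (h₁ : ∀ v, ‖T v‖ ≤ A * ‖v‖) (h₂ : ∀ v, ‖v‖ ≤ A * ‖T v‖)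
    (v : V) :
    dualBallNorm ν (T v) ≤
      A ^ (Module.finrank ℝ (StrongDual 𝕜 V) + 1) * dualBallNorm μ v := by
  refine Real.sqrt_le_iff.2 ⟨mul_nonneg (by positivity) (Real.sqrt_nonneg _), ?_⟩
  refine (dualBallQuadratic_distortion μ ν T hA h₁ h₂ v).trans_eq ?_
  rw [mul_pow, dualBallNorm, Real.sq_sqrt (dualBallQuadratic_nonneg μ v)]
  ring

omit [MeasurableSpace (StrongDual 𝕜 V)] [BorelSpace (StrongDual 𝕜 V)]
  [MeasurableSpace (StrongDual 𝕜 W)] [BorelSpace (StrongDual 𝕜 W)] in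
theorem finrank_real_strongDual_eq (T : V ≃ₗ[𝕜] W) :
    Module.finrank ℝ (StrongDual 𝕜 V) = Module.finrank ℝ (StrongDual 𝕜 W) :=
  ((T.toContinuousLinearEquiv.arrowCongr
    (ContinuousLinearEquiv.refl 𝕜 𝕜)).toLinearEquiv.restrictScalars ℝ).finrank_eq

end DualBall

/-! ### Local almost isometries between fibers. -/

namespace BanachBundle

open Filter

variable {𝕜 : Type w} [RCLike 𝕜] {X : Type u} [TopologicalSpace X] (E : BanachBundle.{u, v, w} 𝕜 X)

theorem finiteDimensional {n : ℕ} (hn : E.IsHomogeneous n) (x : X) :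
    FiniteDimensional 𝕜 (E.fiber x) :=
  Module.rank_lt_aleph0_iff.1 ((hn x).trans_lt Cardinal.natCast_lt_aleph0)

section Operations

variable {E} {Y : Type*} [TopologicalSpace Y] {b : Y → X}

theorem continuous_mk_add {f g : ∀ y, E.fiber (b y)}
    (hf : Continuous fun y => (⟨b y, f y⟩ : TotalSpace 𝕜 E.fiber))
    (hg : Continuous fun y => (⟨b y, g y⟩ : TotalSpace 𝕜 E.fiber)) :
    Continuous fun y => (⟨b y, f y + g y⟩ : TotalSpace 𝕜 E.fiber) := by
  have h : Continuous fun y => (⟨b y, (f y, g y)⟩ : TotalSpace (𝕜 × 𝕜) (E.fiber ×ᵇ E.fiber)) :=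
    (FiberBundle.Prod.isInducing_diag 𝕜 E.fiber 𝕜 E.fiber).continuous_iff.2 (hf.prodMk hg)
  exact E.continuous_add.comp h

theorem continuous_mk_smul {c : Y → 𝕜} {f : ∀ y, E.fiber (b y)} (hc : Continuous c)
    (hf : Continuous fun y => (⟨b y, f y⟩ : TotalSpace 𝕜 E.fiber)) :
    Continuous fun y => (⟨b y, c y • f y⟩ : TotalSpace 𝕜 E.fiber) :=
  E.continuous_smul.comp (hc.prodMk hf)

theorem continuous_mk_zero (hb : Continuous b) :
    Continuous fun y => (⟨b y, 0⟩ : TotalSpace 𝕜 E.fiber) := by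
  have h : Continuous fun x => (⟨x, 0⟩ : TotalSpace 𝕜 E.fiber) := by
    refine continuous_iff_continuousAt.2 fun x => (E.hasBasis_nhds_zero x).tendsto_right_iff.2 ?_
    rintro ⟨U, ε⟩ ⟨hU, hε⟩
    filter_upwards [hU] with y hy
    exact ⟨hy, by simpa using hε⟩
  exact h.comp hb

theorem continuous_mk_sum {ι : Type*} (s : Finset ι) {f : ι → ∀ y, E.fiber (b y)}
    (hb : Continuous b)
    (hf : ∀ i, Continuous fun y => (⟨b y, f i y⟩ : TotalSpace 𝕜 E.fiber)) :
    Continuous fun y => (⟨b y, ∑ i ∈ s, f i y⟩ : TotalSpace 𝕜 E.fiber) := by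
  classical
  induction s using Finset.induction_on with
  | empty => simpa using continuous_mk_zero hb
  | insert i s hi ih =>
    simp only [Finset.sum_insert hi]
    exact continuous_mk_add (hf i) ih

end Operations

/-- Families of vectors in a common fiber. -/
structure Tuple (ι : Type*) where
  /-- The base point. -/
  base : X
  /-- The vectors. -/
  vec : ι → E.fiber base

variable {E} {ι : Type*}

/-- The members of a family of vectors in a common fiber, as points of the total space. -/
def Tuple.toTotal (s : E.Tuple ι) (i : ι) : TotalSpace 𝕜 E.fiber := ⟨s.base, s.vec i⟩

instance : TopologicalSpace (E.Tuple ι) := .induced Tuple.toTotal inferInstance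

theorem Tuple.continuous_toTotal (i : ι) : Continuous fun s : E.Tuple ι => s.toTotal i :=
  (continuous_apply i).comp (continuous_induced_dom (f := Tuple.toTotal))

theorem Tuple.continuous_base [Nonempty ι] : Continuous fun s : E.Tuple ι => s.base :=
  E.continuous_proj.comp (Tuple.continuous_toTotal (Classical.arbitrary ι))

/-- Forgetting all but one member of a family is an open map. -/
theorem Tuple.eventually_exists_extension {κ : Type*} [Finite κ] (s : E.Tuple (Option κ))
    {P : E.Tuple (Option κ) → Prop} (hP : ∀ᶠ t in 𝓝 s, P t) :
    ∀ᶠ p in 𝓝 (s.toTotal none), ∃ f : κ → E.fiber p.proj,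
      P ⟨p.proj, fun i => i.elim p.snd f⟩ := by
  rw [nhds_induced, nhds_pi, eventually_comap] at hP
  obtain ⟨I, t, ht, hI⟩ := Filter.mem_pi'.1 hP
  -- Openness of the projection lifts every nearby base point into the prescribed neighborhood of
  -- each vector.
  have hlift : ∀ᶠ p in 𝓝 (s.toTotal none), ∀ k : κ, p.proj ∈ TotalSpace.proj '' t (some k) :=
    eventually_all.2 fun k => by
      have h : TotalSpace.proj '' t (some k) ∈ 𝓝 s.base :=
        E.isOpenMap_proj.image_mem_nhds (ht (some k))
      exact E.continuous_proj.continuousAt.preimage_mem_nhds h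
  filter_upwards [hlift, ht none] with p hp hp'
  have hp (k : κ) : ∃ v : E.fiber p.proj, (⟨p.proj, v⟩ : TotalSpace 𝕜 E.fiber) ∈ t (some k) := by
    obtain ⟨⟨y, v⟩, hq, rfl : y = p.proj⟩ := hp k
    exact ⟨v, hq⟩
  choose f hf using hp
  refine ⟨f, @hI _ (fun i _ => ?_) ⟨p.proj, fun i => i.elim p.snd f⟩ rfl⟩
  cases i with
  | none => exact hp'
  | some k => exact hf k

theorem linearMap_norm_bounds {V W : Type*} [NormedAddCommGroup V] [NormedSpace 𝕜 V]
    [NormedAddCommGroup W] [NormedSpace 𝕜 W] (L : V →ₗ[𝕜] W) {A : ℝ} (hA : 0 < A)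
    (h : ∀ v, ‖v‖ = 1 → A⁻¹ < ‖L v‖ ∧ ‖L v‖ < A) (v : V) :
    ‖L v‖ ≤ A * ‖v‖ ∧ ‖v‖ ≤ A * ‖L v‖ := by
  rcases eq_or_ne v 0 with rfl | hv
  · simp
  have hv' : 0 < ‖v‖ := norm_pos_iff.2 hv
  have := h (((‖v‖⁻¹ : ℝ) : 𝕜) • v) (by simp [norm_smul, hv'.ne'])
  rw [map_smul, norm_smul, RCLike.norm_ofReal, abs_of_pos (by positivity), lt_inv_mul_iff₀ hv',
    inv_mul_lt_iff₀ hv', ← div_eq_mul_inv, div_lt_iff₀ hA] at this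
  constructor <;> linarith

/-- Near a point, the fibers are almost isometric, compatibly with that point. -/
theorem eventually_exists_almost_isometry (hE : E.IsContinuous) {n : ℕ} (hn : E.IsHomogeneous n)
    (p₀ : TotalSpace 𝕜 E.fiber) {δ : ℝ} (hδ : 0 < δ) :
    ∀ᶠ p in 𝓝 p₀, ∃ L : E.fiber p₀.proj ≃ₗ[𝕜] E.fiber p.proj,
      (∀ v, ‖L v‖ ≤ (1 + δ) * ‖v‖) ∧ (∀ v, ‖v‖ ≤ (1 + δ) * ‖L v‖) ∧
        ‖p.snd - L p₀.snd‖ < δ := by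
  have hfin (x : X) : FiniteDimensional 𝕜 (E.fiber x) :=
    Module.rank_lt_aleph0_iff.1 ((hn x).trans_lt (Cardinal.natCast_lt_aleph0))
  have hrank (x : X) : Module.finrank 𝕜 (E.fiber x) = n := Module.finrank_eq_of_rank_eq (hn x)
  have := FiniteDimensional.proper_rclike 𝕜 (E.fiber p₀.proj)
  let e := Module.finBasis 𝕜 (E.fiber p₀.proj)
  let κ := Fin (Module.finrank 𝕜 (E.fiber p₀.proj))
  -- A basis of the fiber, with the point `p₀` itself adjoined at index `none`.
  let s₀ : E.Tuple (Option κ) := ⟨p₀.proj, fun i => i.elim p₀.snd e⟩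
  let L (s : E.Tuple (Option κ)) : E.fiber p₀.proj →ₗ[𝕜] E.fiber s.base :=
    e.constr 𝕜 fun k => s.vec (some k)
  have hL (s v) : L s v = ∑ k, e.repr v k • s.vec (some k) := e.constr_apply_fintype 𝕜 _ _
  have hL₀ (v) : L s₀ v = v := (hL s₀ v).trans (e.sum_repr v)
  have hLc : Continuous fun q : E.fiber p₀.proj × E.Tuple (Option κ) =>
      (⟨q.2.base, L q.2 q.1⟩ : TotalSpace 𝕜 E.fiber) := by
    simp only [hL]
    refine continuous_mk_sum _ (Tuple.continuous_base.comp continuous_snd) fun k => ?_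
    refine continuous_mk_smul ?_ ((Tuple.continuous_toTotal (some k)).comp continuous_snd)
    exact ((e.coord k).continuous_of_finiteDimensional).comp continuous_fst
  have hLn : Continuous fun q : E.Tuple (Option κ) × E.fiber p₀.proj => ‖L q.1 q.2‖ :=
    hE.comp (hLc.comp continuous_swap)
  have hA : (0 : ℝ) < 1 + δ := by positivity
  have h₁ : ∀ᶠ s in 𝓝 s₀, ∀ v ∈ Metric.sphere (0 : E.fiber p₀.proj) 1,
      (1 + δ)⁻¹ < ‖L s v‖ ∧ ‖L s v‖ < 1 + δ := by
    -- Compactness of the unit sphere makes the neighborhood of `s₀` independent of `v`.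
    refine (isCompact_sphere _ _).eventually_forall_of_forall_eventually fun v hv => ?_
    have hv : ‖L s₀ v‖ = 1 := by rw [hL₀]; simpa using hv
    refine hLn.continuousAt.eventually (Ioo_mem_nhds ?_ ?_)
    · change _ < ‖L s₀ v‖
      rw [hv]
      exact inv_lt_one_of_one_lt₀ (by linarith)
    · change ‖L s₀ v‖ < _
      rw [hv]
      linarith
  have h₂ : ∀ᶠ s in 𝓝 s₀, ‖s.vec none - L s p₀.snd‖ < δ := by
    -- The difference is written with `(-1) • _`, since the bundle axioms give continuity of sums
    -- and scalar multiples.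
    have hc : Continuous fun s : E.Tuple (Option κ) => ‖s.vec none + (-1 : 𝕜) • L s p₀.snd‖ :=
      hE.comp (continuous_mk_add (Tuple.continuous_toTotal none)
        (continuous_mk_smul continuous_const
          (hLc.comp (continuous_const.prodMk continuous_id))))
    simp only [neg_one_smul, ← sub_eq_add_neg] at hc
    refine hc.continuousAt.eventually (gt_mem_nhds ?_)
    change ‖s₀.vec none - L s₀ p₀.snd‖ < δ
    rw [hL₀]
    simpa [s₀] using hδ
  filter_upwards [Tuple.eventually_exists_extension s₀ (h₁.and h₂)] with p ⟨f, hf₁, hf₂⟩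
  have hb := linearMap_norm_bounds (L ⟨p.proj, fun i => i.elim p.snd f⟩) hA
    fun v hv => hf₁ v (by simpa using hv)
  have hinj : Function.Injective (L ⟨p.proj, fun i => i.elim p.snd f⟩) := by
    rw [injective_iff_map_eq_zero]
    intro v hv
    have := (hb v).2
    rw [hv, norm_zero, mul_zero] at this
    exact norm_le_zero_iff.1 this
  exact ⟨LinearMap.linearEquivOfInjective _ hinj ((hrank _).trans (hrank _).symm),
    fun v => (hb v).1, fun v => (hb v).2, hf₂⟩

end BanachBundle

/-! ### Continuity of the averaged norm, and renorming. -/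

namespace BanachBundle

open Filter MeasureTheory

variable {𝕜 : Type w} [RCLike 𝕜] {X : Type u} [TopologicalSpace X] (E : BanachBundle.{u, v, w} 𝕜 X)

instance (x : X) : MeasurableSpace (StrongDual 𝕜 (E.fiber x)) := borel _

instance (x : X) : BorelSpace (StrongDual 𝕜 (E.fiber x)) := ⟨rfl⟩

theorem exists_haar {n : ℕ} (hn : E.IsHomogeneous n) :
    ∃ μ : ∀ x, Measure (StrongDual 𝕜 (E.fiber x)), ∀ x, (μ x).IsAddHaarMeasure := by
  have (x : X) : ∃ μ : Measure (StrongDual 𝕜 (E.fiber x)), μ.IsAddHaarMeasure := by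
    have : FiniteDimensional 𝕜 (E.fiber x) := E.finiteDimensional hn x
    have := StrongDual.properSpace (𝕜 := 𝕜) (V := E.fiber x)
    exact ⟨Measure.addHaar, inferInstance⟩
  choose μ hμ using this
  exact ⟨μ, hμ⟩

variable {E}

theorem finrank_real_strongDual_fiber {n : ℕ} (hn : E.IsHomogeneous n) (x y : X) :
    Module.finrank ℝ (StrongDual 𝕜 (E.fiber x)) = Module.finrank ℝ (StrongDual 𝕜 (E.fiber y)) := by
  have := E.finiteDimensional hn
  obtain ⟨T⟩ := nonempty_linearEquiv_of_rank_eq ((hn x).trans (hn y).symm)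
  exact finrank_real_strongDual_eq T

/-- A squeeze: an almost isometry `L` costs a factor `(1 + δ)^d` in either direction, and replacing
`p` by `L p₀` costs `δ` because the averaged norm is dominated by the given one. Let `δ → 0`. -/
theorem continuous_dualBallNorm (hE : E.IsContinuous) {n : ℕ} (hn : E.IsHomogeneous n)
    (μ : ∀ x, Measure (StrongDual 𝕜 (E.fiber x))) [∀ x, (μ x).IsAddHaarMeasure] :
    Continuous fun p : TotalSpace 𝕜 E.fiber => dualBallNorm (μ p.proj) p.snd := by
  have := E.finiteDimensional hn
  refine continuous_iff_continuousAt.2 fun p₀ => ?_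
  set d := Module.finrank ℝ (StrongDual 𝕜 (E.fiber p₀.proj)) + 1
  set h₀ := dualBallNorm (μ p₀.proj) p₀.snd with hh₀
  have hlow : Tendsto (fun δ : ℝ => ((1 + δ) ^ d)⁻¹ * h₀ - δ) (𝓝[>] 0) (𝓝 h₀) := by
    refine tendsto_nhdsWithin_of_tendsto_nhds ?_
    have : ContinuousAt (fun δ : ℝ => ((1 + δ) ^ d)⁻¹ * h₀ - δ) 0 := by
      fun_prop (disch := simp)
    simpa [ContinuousAt] using this
  have hupp : Tendsto (fun δ : ℝ => (1 + δ) ^ d * h₀ + δ) (𝓝[>] 0) (𝓝 h₀) := by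
    refine tendsto_nhdsWithin_of_tendsto_nhds ?_
    have : ContinuousAt (fun δ : ℝ => (1 + δ) ^ d * h₀ + δ) 0 := by
      fun_prop
    simpa [ContinuousAt] using this
  have key {δ : ℝ} (hδ : 0 < δ) : ∀ᶠ p in 𝓝 p₀,
      ((1 + δ) ^ d)⁻¹ * h₀ - δ ≤ dualBallNorm (μ p.proj) p.snd ∧
        dualBallNorm (μ p.proj) p.snd ≤ (1 + δ) ^ d * h₀ + δ := by
    filter_upwards [eventually_exists_almost_isometry hE hn p₀ hδ] with p ⟨L, h₁, h₂, h₃⟩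
    have hA : (0 : ℝ) < 1 + δ := by positivity
    have i₁ := dualBallNorm_distortion (μ p₀.proj) (μ p.proj) L hA h₁ h₂ p₀.snd
    have i₂ := dualBallNorm_distortion (μ p.proj) (μ p₀.proj) L.symm hA
      (fun v => by simpa using h₂ (L.symm v)) (fun v => by simpa using h₁ (L.symm v)) (L p₀.snd)
    rw [L.symm_apply_apply, finrank_real_strongDual_fiber hn p.proj p₀.proj,
      ← inv_mul_le_iff₀ (by positivity)] at i₂
    have i₃ := dualBallNorm_le_add (μ p.proj) p.snd (L p₀.snd)
    have i₄ := dualBallNorm_le_add (μ p.proj) (L p₀.snd) p.snd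
    rw [norm_sub_rev] at i₄
    constructor <;> linarith
  refine tendsto_order.2 ⟨fun a ha => ?_, fun a ha => ?_⟩
  · obtain ⟨δ, hδ, hδ'⟩ := ((hlow.eventually (lt_mem_nhds ha)).and self_mem_nhdsWithin).exists
    filter_upwards [key hδ'] with p hp using hδ.trans_le hp.1
  · obtain ⟨δ, hδ, hδ'⟩ := ((hupp.eventually (gt_mem_nhds ha)).and self_mem_nhdsWithin).exists
    filter_upwards [key hδ'] with p hp using hp.2.trans_lt hδ

/-- The normed space structure of an inner product space core, over its own norm. -/
@[reducible]
noncomputable def normedSpaceOfCore {V : Type*} [AddCommGroup V] [Module 𝕜 V]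
    (c : InnerProductSpace.Core 𝕜 V) :
    @NormedSpace 𝕜 V _ c.toNormedAddCommGroup.toSeminormedAddCommGroup :=
  letI := c.toNormedAddCommGroup
  (InnerProductSpace.ofCore c.toCore).toNormedSpace

theorem completeSpace_of_core {V : Type*} [AddCommGroup V] [Module 𝕜 V]
    (hV : FiniteDimensional 𝕜 V) (c : InnerProductSpace.Core 𝕜 V) :
    @CompleteSpace V c.toNormedAddCommGroup.toMetricSpace.toUniformSpace :=
  letI := c.toNormedAddCommGroup
  letI := normedSpaceOfCore c
  @FiniteDimensional.complete 𝕜 V _ _ _ _ _ _ _ _ hV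

/-- A Banach bundle with finite-dimensional fibers, renormed by a continuous family of inner
products that is uniformly equivalent to the given norms. -/
@[reducible]
noncomputable def withInner (E : BanachBundle.{u, v, w} 𝕜 X)
    (hfin : ∀ x, FiniteDimensional 𝕜 (E.fiber x))
    (c : ∀ x, InnerProductSpace.Core 𝕜 (E.fiber x))
    (hc : Continuous fun p : TotalSpace 𝕜 E.fiber =>
      (c p.proj).toNormedAddCommGroup.toNorm.norm p.snd)
    {r : ℝ} (hr : 0 < r)
    (h₁ : ∀ x (v : E.fiber x), (c x).toNormedAddCommGroup.toNorm.norm v ≤ ‖v‖)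
    (h₂ : ∀ x (v : E.fiber x), r * ‖v‖ ≤ (c x).toNormedAddCommGroup.toNorm.norm v) :
    BanachBundle.{u, v, w} 𝕜 X where
  fiber := E.fiber
  normedAddCommGroup x := (c x).toNormedAddCommGroup
  normedSpace x := normedSpaceOfCore (c x)
  completeSpace x := completeSpace_of_core (hfin x) (c x)
  topology := E.topology
  continuous_proj := E.continuous_proj
  isOpenMap_proj := E.isOpenMap_proj
  continuous_smul := E.continuous_smul
  continuous_add := E.continuous_add
  upperSemicontinuous_norm := hc.upperSemicontinuous
  hasBasis_nhds_zero x := by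
    refine (E.hasBasis_nhds_zero x).to_hasBasis ?_ ?_
    · rintro ⟨U, ε⟩ ⟨hU, hε⟩
      -- One `r` serves all fibers over `U`, so the new tube of radius `r * ε` lies in the old one
      -- of radius `ε`.
      refine ⟨(U, r * ε), ⟨hU, mul_pos hr hε⟩, fun p hp => ⟨hp.1, ?_⟩⟩
      exact lt_of_mul_lt_mul_left ((h₂ _ _).trans_lt hp.2) hr.le
    · rintro ⟨U, ε⟩ ⟨hU, hε⟩
      exact ⟨(U, ε), ⟨hU, hε⟩, fun p hp => ⟨hp.1, (h₁ _ _).trans_lt hp.2⟩⟩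

end BanachBundle

theorem mainTheorem8 {𝕜 : Type w} [RCLike 𝕜] {X : Type u} [TopologicalSpace X] [T2Space X]
    (hX : IsLocallyParacompact X) (E : BanachBundle.{u, v, w} 𝕜 X) (hE : E.IsContinuous)
    (n : ℕ) (hn : E.IsHomogeneous n) : E.IsUnitarizable := by
  -- A base point is needed to express the uniform constant through the dimension of one fiber.
  rcases isEmpty_or_nonempty X with hX₀ | ⟨⟨x₀⟩⟩
  · exact ⟨E, fun x => hX₀.elim x, id, fun x => .refl 𝕜 (E.fiber x), IsHomeomorph.id⟩
  have hfin := E.finiteDimensional hn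
  obtain ⟨μ, hμ⟩ := E.exists_haar hn
  refine ⟨E.withInner hfin (fun x => dualBallCore (μ x)) ?_ (r := (1 / 4) ^
    (Module.finrank ℝ (StrongDual 𝕜 (E.fiber x₀)) + 2)) (by positivity) (fun x v => ?_)
    (fun x v => ?_), fun x => ⟨_, rfl⟩, fun _ => ?_, fun x => .refl 𝕜 (E.fiber x), IsHomeomorph.id⟩
  · simpa only [dualBallCore_norm] using BanachBundle.continuous_dualBallNorm hE hn μ
  · rw [dualBallCore_norm]
    exact dualBallNorm_le (μ x) v
  · rw [dualBallCore_norm, BanachBundle.finrank_real_strongDual_fiber hn x₀ x]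
    exact le_dualBallNorm (μ x) v
  · have h := BanachBundle.continuous_dualBallNorm hE hn μ
    simp only [← dualBallCore_norm] at h
    exact h
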